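/- **Setting.** For every $R>0$ and $G>0$ there is a constant $c$, depending only on $R$ and $G$, such that the following holds for every dimension $d$, every horizon $T\ge 1$ and every compact convex set $\mathcal X\subset\mathbb R^d$ with $0\in\mathcal X\subseteq\{x:\|x\|\le R\}$. Write $\Pi$ for the Euclidean projection onto $\mathcal X$. **Experts.** For $\sigma>0$ and an integer $k\ge1$, the $k$-lazyGD expert fed with gradients $g_1,g_2,\dots$ plays $x_1=0$ and $$x_{t+1}=\Pi\Big(x_{t-n_t}-\tfrac1\sigma\sum_{\tau=t-n_t}^{t} g_\tau\Big),\qquad n_t=(t-1)\bmod k .$$ Let $B=\sqrt{(G^2+2G)T/R^2}$, $N=\lceil\tfrac12\log_2(8T-7)\rceil+1$ and $\mathcal H=\{\sigma^{(i)}=B/2^{i-1}: i=1,\dots,N\}$. Expert $i$ is $k$-lazyGD with $\sigma=\sigma^{(i)}$ and $k=\max(1,\lfloor \tfrac{2R}{G}\sigma^{(i)}\rfloor)$; denote its decisions by $x^{(i)}_t$, and put $x^{(i)}_0=x^{(i)}_1=0$. **Meta-learner (SAder).** Let $\alpha=\frac{2}{(2G+1)\,2R}\sqrt{\frac{2}{5T}}$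 and $w^{(i)}_1=\frac{1+1/N}{i(i+1)}$. In round $t=1,\dots,T$ the learner plays $x_t=\sum_{i=1}^N w_t^{(i)}x_t^{(i)}$, a convex loss $f_t:\mathcal X\to\mathbb R$ is revealed, a subgradient $g_t\in\partial f_t(x_t)$ is passed on to all experts, and the weights are updated by $$w_{t+1}^{(i)}=\frac{w_t^{(i)}e^{-\alpha \ell_t^{(i)}}}{\sum_{j=1}^N w_t^{(j)}e^{-\alpha \ell_t^{(j)}}},\qquad \ell_t^{(i)}=\langle g_t,x_t^{(i)}-x_t\rangle+\|x_t^{(i)}-x_{t-1}^{(i)}\| .$$ **Claim.** For all convex losses $f_1,\dots,f_T$ and all choices of the subgradients $g_t\in\partial f_t(x_t)$ with $\|g_t\|\le G$ for $t=1,\dots,T$, the decisions of the meta-learner satisfy, simultaneously for every comparator sequence $u_1,\dots,u_T\in\mathcal X$ with path length $P_T=\sum_{t=1}^{T-1}\|u_{t+1}-u_t\|$ (which the learner does not know), $$\mathcal R_T=\sum_{t=1}^T\big(f_t(x_t)-f_t(u_t)\big)+\sum_{t=1}^{T-1}\|x_{t+1}-x_t\|\;\le\; c\,\sqrt{(P_T+1)\,T}.$$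 -/

import Mathlib

open Finset

noncomputable section

namespace PartialLazy

/-- The Euclidean projection `Π(z) = argmin_{x ∈ X} ‖x - z‖` (a minimizer exists as soon as `X` is
compact and nonempty, and it is unique if `X` is convex). -/
def proj {d : ℕ} (X : Set (EuclideanSpace ℝ (Fin d))) (z : EuclideanSpace ℝ (Fin d)) :
    EuclideanSpace ℝ (Fin d) :=
  Classical.epsilon fun x => x ∈ X ∧ ∀ y ∈ X, ‖x - z‖ ≤ ‖y - z‖

theorem proj_spec {d : ℕ} {X : Set (EuclideanSpace ℝ (Fin d))} (hX : IsCompact X)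
    (hne : X.Nonempty) (z : EuclideanSpace ℝ (Fin d)) :
    proj X z ∈ X ∧ ∀ y ∈ X, ‖proj X z - z‖ ≤ ‖y - z‖ := by
  have h : ∃ x, x ∈ X ∧ ∀ y ∈ X, ‖x - z‖ ≤ ‖y - z‖ := by
    obtain ⟨x, hx, hmin⟩ := hX.exists_isMinOn hne
      (f := fun x => ‖x - z‖) (by fun_prop)
    exact ⟨x, hx, fun y hy => hmin hy⟩
  exact Classical.epsilon_spec h

/-- `g` is a subgradient at `x` of `f`, seen as a function on `X` (that is, extended by `+∞`
outside `X`). -/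
def IsSubgradientOn {d : ℕ} (X : Set (EuclideanSpace ℝ (Fin d)))
    (f : EuclideanSpace ℝ (Fin d) → ℝ) (x g : EuclideanSpace ℝ (Fin d)) : Prop :=
  ∀ y ∈ X, f x + inner ℝ g (y - x) ≤ f y

/-- The iterates of `k`-lazyGD on the gradient sequence `g 1, g 2, …`:
`x 1 = 0` and, for `t ≥ 1`,
`x (t+1) = Π (x (t - n) - (1/σ) ∑_{τ = t-n}^{t} g τ)` with `n = (t-1) mod k`.
Rounds are numbered from `1`; the value at `0` is the convention `x 0 = x 1`.
In the last clause the round `t` above is `s + 1`, so that `n = s % k`. -/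
def kLazyGD {d : ℕ} (X : Set (EuclideanSpace ℝ (Fin d))) (σ : ℝ) (k : ℕ)
    (g : ℕ → EuclideanSpace ℝ (Fin d)) : ℕ → EuclideanSpace ℝ (Fin d)
  | 0 => 0
  | 1 => 0
  | s + 2 => proj X (kLazyGD X σ k g (s + 1 - s % k)
      - (1 / σ) • ∑ τ ∈ Icc (s + 1 - s % k) (s + 1), g τ)
termination_by t => t
decreasing_by omega

/-- The weighted average `∑_{i=1}^N w_i x_i` of expert decisions. -/
def average {d : ℕ} (N : ℕ) (w : ℕ → ℝ) (x : ℕ → EuclideanSpace ℝ (Fin d)) :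
    EuclideanSpace ℝ (Fin d) :=
  ∑ i ∈ Icc 1 N, w i • x i

/-- One step of exponential weights with step size `α` and losses `ℓ i`, over experts `1, …, N`. -/
def hedgeUpdate (N : ℕ) (α : ℝ) (w ℓ : ℕ → ℝ) (i : ℕ) : ℝ :=
  w i * Real.exp (-α * ℓ i) / ∑ j ∈ Icc 1 N, w j * Real.exp (-α * ℓ j)

/-- The SAder weights `w_t^i`, over experts `i = 1, …, N` whose decisions are `y i t`, where `g t` is
the gradient revealed in round `t`. The initial weights are `w_1^i = C / (i (i+1))`, with
`C = 1 + 1/N` (so that they sum to `1`); then `w_{t+1}` is the exponential-weights update of `w_t`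
with the losses `⟪g_t, y_t^i - x_t⟫ + ‖y_t^i - y_{t-1}^i‖`, where `x_t = ∑ w_t^i y_t^i`.
In the last clause the round `t` is `s + 1`. -/
def saderWeight {d : ℕ} (N : ℕ) (α : ℝ) (y : ℕ → ℕ → EuclideanSpace ℝ (Fin d))
    (g : ℕ → EuclideanSpace ℝ (Fin d)) : ℕ → ℕ → ℝ
  | 0 => fun i => (1 + 1 / (N : ℝ)) / ((i : ℝ) * ((i : ℝ) + 1))
  | 1 => fun i => (1 + 1 / (N : ℝ)) / ((i : ℝ) * ((i : ℝ) + 1))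
  | s + 2 => hedgeUpdate N α (saderWeight N α y g (s + 1)) fun i =>
      inner ℝ (g (s + 1))
        (y i (s + 1) - average N (saderWeight N α y g (s + 1)) fun j => y j (s + 1))
      + ‖y i (s + 1) - y i s‖

/-- The SAder decision `x_t = ∑ w_t^i y_t^i`. -/
def saderDecision {d : ℕ} (N : ℕ) (α : ℝ) (y : ℕ → ℕ → EuclideanSpace ℝ (Fin d))
    (g : ℕ → EuclideanSpace ℝ (Fin d)) (t : ℕ) : EuclideanSpace ℝ (Fin d) :=
  average N (saderWeight N α y g t) fun i => y i t

/-- The number `N = ⌈(1/2) log₂ (8T - 7)⌉ + 1` of experts. -/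
def gridSize (T : ℕ) : ℕ := ⌈(1 / 2 : ℝ) * Real.logb 2 (8 * (T : ℝ) - 7)⌉₊ + 1

/-- The grid point `σ^{(i)} = B / 2^{i-1}`, with `B = √((G² + 2G) T / R²)`, for `i = 1, …, N`. -/
def gridSigma (R G : ℝ) (T : ℕ) (i : ℕ) : ℝ :=
  √((G ^ 2 + 2 * G) * (T : ℝ) / R ^ 2) / 2 ^ (i - 1)

/-- The laziness slack `k = max(1, ⌊(2R/G) σ⌋)` tied to `σ`. -/
def slack (R G σ : ℝ) : ℕ := max 1 ⌊2 * R / G * σ⌋₊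

/-- The step size `α = 2 / ((2G+1) D) · √(2 / (5T))` of the meta-learner, with `D = 2R`. -/
def metaStep (R G : ℝ) (T : ℕ) : ℝ := 2 / ((2 * G + 1) * (2 * R)) * √(2 / (5 * (T : ℝ)))

/-- The decision in round `t` of SAder over the grid of `k`-lazyGD experts, when the gradients
revealed to the meta-learner, and passed on to all experts, are `g 1, g 2, …`. It depends only on
`g 1, …, g (t-1)`. -/
def ensemble {d : ℕ} (R G : ℝ) (T : ℕ) (X : Set (EuclideanSpace ℝ (Fin d)))
    (g : ℕ → EuclideanSpace ℝ (Fin d)) (t : ℕ) : EuclideanSpace ℝ (Fin d) :=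
  saderDecision (gridSize T) (metaStep R G T)
    (fun i => kLazyGD X (gridSigma R G T i) (slack R G (gridSigma R G T i)) g) g t

/-- The path length `∑_{t=1}^{T-1} ‖u_{t+1} - u_t‖`. -/
def pathLength {d : ℕ} (T : ℕ) (u : ℕ → EuclideanSpace ℝ (Fin d)) : ℝ :=
  ∑ t ∈ Icc 1 (T - 1), ‖u (t + 1) - u t‖

/-- Dynamic regret with switching cost:
`∑_{t=1}^T (f_t (x_t) - f_t (u_t)) + ∑_{t=1}^{T-1} ‖x_{t+1} - x_t‖`. -/
def regret {d : ℕ} (T : ℕ) (f : ℕ → EuclideanSpace ℝ (Fin d) → ℝ)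
    (x u : ℕ → EuclideanSpace ℝ (Fin d)) : ℝ :=
  (∑ t ∈ Icc 1 T, (f t (x t) - f t (u t))) + ∑ t ∈ Icc 1 (T - 1), ‖x (t + 1) - x t‖

end PartialLazy

end

namespace PartialLazy


/-! The subgradient inequality reduces losses to linear ones. Two estimates are then added: a bound
for each expert and a bound for the learner relative to any expert.

Expert (`kLazyGD_regret`). Each block of `k` rounds is dual averaging restarted at the block's first
point, so be-the-leader bounds the lookahead regret there by a drop of `σ/2 * ‖u - x‖ ^ 2`.
Comparator drift costs `O(Rσ)` per unit of path, both in this potential and inside a block, the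
latter because `G * (k - 1) ≤ 2Rσ`. Consecutive iterates differ by at most `G/σ`, which pays for the
lookahead and for switching. In total: `O(σ(1 + P) + T/σ)`.

Learner (`sader_meta_regret`). The linear parts of the meta-losses have weighted mean zero, so the
mean meta-loss is the mean movement of the experts. Since Hedge controls this quantity, it also
controls the learner's switching cost, up to the `O(α)` movement of the weights per round. The
overhead is `O(2 ^ (i - 1) / α + αT)`.

Tuning. Some grid index has `2 ^ (i - 1)` within a factor 2 of `√(1 + P/R)`. With `σ` of order `√T /
2 ^ (i - 1)` and `α` of order `1/√T`, every term is `O(√((P + 1) T))`. The prior cost of an expert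
is charged to `2 ^ (i - 1)`, hence no factor depending on `N` appears. -/

/-! ### Euclidean projection -/

theorem inner_sub_proj_le_zero {d : ℕ} {X : Set (EuclideanSpace ℝ (Fin d))} (hc : Convex ℝ X)
    (hX : IsCompact X) (hne : X.Nonempty) (z : EuclideanSpace ℝ (Fin d))
    {y : EuclideanSpace ℝ (Fin d)} (hy : y ∈ X) :
    inner ℝ (z - proj X z) (y - proj X z) ≤ 0 := by
  obtain ⟨hp, hmin⟩ := proj_spec hX hne z
  refine (norm_eq_iInf_iff_real_inner_le_zero hc hp).1 ?_ y hy
  have : Nonempty X := hne.to_subtype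
  refine le_antisymm (le_ciInf fun w => ?_)
    (ciInf_le (f := fun w : X => ‖z - w‖) ⟨0, ?_⟩ ⟨proj X z, hp⟩)
  · rw [norm_sub_rev z, norm_sub_rev z]
    exact hmin w w.2
  · rintro _ ⟨w, rfl⟩
    exact norm_nonneg _

theorem norm_proj_sub_proj_le {d : ℕ} {X : Set (EuclideanSpace ℝ (Fin d))} (hc : Convex ℝ X)
    (hX : IsCompact X) (hne : X.Nonempty) (z z' : EuclideanSpace ℝ (Fin d)) :
    ‖proj X z - proj X z'‖ ≤ ‖z - z'‖ := by
  have h1 := inner_sub_proj_le_zero hc hX hne z (proj_spec hX hne z').1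
  have h2 := inner_sub_proj_le_zero hc hX hne z' (proj_spec hX hne z).1
  set p := proj X z
  set q := proj X z'
  have h3 : ‖p - q‖ * ‖p - q‖ ≤ inner ℝ (z - z') (p - q) := by
    rw [← real_inner_self_eq_norm_mul_norm]
    simp only [inner_sub_left, inner_sub_right] at *
    linarith
  have h4 := real_inner_le_norm (z - z') (p - q)
  by_contra! h
  nlinarith [norm_nonneg (z - z'), norm_nonneg (p - q)]

theorem proj_eq_self {d : ℕ} {X : Set (EuclideanSpace ℝ (Fin d))} (hX : IsCompact X)
    {z : EuclideanSpace ℝ (Fin d)} (hz : z ∈ X) : proj X z = z := by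
  have h := (proj_spec hX ⟨z, hz⟩ z).2 z hz
  rw [sub_self, norm_zero] at h
  exact sub_eq_zero.1 (norm_le_zero_iff.1 h)

/-- Strong convexity of `v ↦ ⟪S, v⟫ + (σ/2) ‖v - c‖²` at its minimizer over `X`. -/
theorem proj_three_point {d : ℕ} {X : Set (EuclideanSpace ℝ (Fin d))} (hc : Convex ℝ X)
    (hX : IsCompact X) {σ : ℝ} (hσ : 0 < σ) (c S : EuclideanSpace ℝ (Fin d))
    {v : EuclideanSpace ℝ (Fin d)} (hv : v ∈ X) :
    inner ℝ S (proj X (c - (1 / σ) • S)) + σ / 2 * ‖proj X (c - (1 / σ) • S) - c‖ ^ 2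
      + σ / 2 * ‖v - proj X (c - (1 / σ) • S)‖ ^ 2 ≤ inner ℝ S v + σ / 2 * ‖v - c‖ ^ 2 := by
  have h := inner_sub_proj_le_zero hc hX ⟨v, hv⟩ (c - (1 / σ) • S) hv
  set p := proj X (c - (1 / σ) • S)
  have h1 : c - (1 / σ) • S - p = (c - p) - (1 / σ) • S := by abel
  rw [h1, inner_sub_left, inner_smul_left, inner_sub_right S] at h
  simp only [conj_trivial] at h
  have h2 : σ * inner ℝ (c - p) (v - p) ≤ inner ℝ S v - inner ℝ S p := by
    have := mul_le_mul_of_nonneg_left h hσ.le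
    rw [mul_sub, ← mul_assoc, mul_one_div_cancel hσ.ne', one_mul, mul_zero] at this
    linarith
  have h3 : ‖v - c‖ ^ 2 = ‖v - p‖ ^ 2 - 2 * inner ℝ (c - p) (v - p) + ‖p - c‖ ^ 2 := by
    have : v - c = (v - p) - (c - p) := by abel
    rw [this, norm_sub_sq_real, real_inner_comm, norm_sub_rev p c]
  rw [h3]
  nlinarith

/-! ### Dynamic regret and switching cost of one `k`-lazyGD expert -/

section Expert

variable {d : ℕ} {X : Set (EuclideanSpace ℝ (Fin d))} {σ : ℝ} {k : ℕ}
  {g : ℕ → EuclideanSpace ℝ (Fin d)}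

theorem kLazyGD_zero : kLazyGD X σ k g 0 = 0 := by rw [kLazyGD]

theorem kLazyGD_one : kLazyGD X σ k g 1 = 0 := by rw [kLazyGD]

theorem kLazyGD_mem (hX : IsCompact X) (h0 : 0 ∈ X) (t : ℕ) : kLazyGD X σ k g t ∈ X := by
  match t with
  | 0 => rwa [kLazyGD_zero]
  | 1 => rwa [kLazyGD_one]
  | s + 2 => rw [kLazyGD]; exact (proj_spec hX ⟨0, h0⟩ _).1

theorem sum_Icc_add (f : ℕ → EuclideanSpace ℝ (Fin d)) (a n : ℕ) :
    ∑ τ ∈ Icc (a + 1) (a + n), f τ = ∑ i ∈ range n, f (a + i + 1) := by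
  induction n with
  | zero => simp
  | succ n ih => rw [sum_range_succ, ← ih, ← add_assoc, sum_Icc_succ_top (by omega)]

/-- Within a block, `k`-lazyGD performs dual averaging from the first point of the block. -/
theorem kLazyGD_block (hX : IsCompact X) (h0 : 0 ∈ X) (q : ℕ) {m : ℕ} (hm : m ≤ k) :
    kLazyGD X σ k g (q * k + m + 1) = proj X (kLazyGD X σ k g (q * k + 1)
      - (1 / σ) • ∑ i ∈ range m, g (q * k + i + 1)) := by
  cases m with
  | zero => simp [proj_eq_self hX (kLazyGD_mem hX h0 _)]
  | succ j =>
    have hmod : (q * k + j) % k = j := by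
      rw [mul_comm, Nat.mul_add_mod, Nat.mod_eq_of_lt hm]
    rw [show q * k + (j + 1) + 1 = (q * k + j) + 2 by ring, kLazyGD, hmod,
      show q * k + j + 1 - j = q * k + 1 by omega, add_assoc (q * k) j 1, sum_Icc_add]

theorem norm_kLazyGD_succ_sub_le (hc : Convex ℝ X) (hX : IsCompact X) (h0 : 0 ∈ X) (hσ : 0 < σ)
    (hk : 1 ≤ k) (t : ℕ) :
    ‖kLazyGD X σ k g (t + 2) - kLazyGD X σ k g (t + 1)‖ ≤ ‖g (t + 1)‖ / σ := by
  have hlt : t % k < k := Nat.mod_lt _ hk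
  have ht : t / k * k + t % k = t := Nat.div_add_mod' t k
  have e1 := kLazyGD_block (σ := σ) (g := g) hX h0 (t / k) hlt.le
  have e2 := kLazyGD_block (σ := σ) (g := g) hX h0 (t / k) (Nat.succ_le_of_lt hlt)
  rw [Nat.succ_eq_add_one, sum_range_succ, ← add_assoc, ht] at e2
  rw [ht] at e1
  rw [e1, e2]
  refine (norm_proj_sub_proj_le hc hX ⟨0, h0⟩ _ _).trans (le_of_eq ?_)
  rw [sub_sub_sub_cancel_left, ← smul_sub, sub_add_cancel_left, norm_smul, norm_neg,
    Real.norm_of_nonneg (by positivity)]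
  ring

/-- Be-the-leader: each iterate minimizes the accumulated linear loss plus the quadratic centred at
the block start. The last minimizer is finally compared with `v` by strong convexity. -/
theorem kLazyGD_block_static (hc : Convex ℝ X) (hX : IsCompact X) (h0 : 0 ∈ X) (hσ : 0 < σ)
    (q : ℕ) {m : ℕ} (hm : m ≤ k) {v : EuclideanSpace ℝ (Fin d)} (hv : v ∈ X) :
    ∑ j ∈ range m, inner ℝ (g (q * k + j + 1)) (kLazyGD X σ k g (q * k + j + 2) - v)
      + σ / 2 * ‖v - kLazyGD X σ k g (q * k + m + 1)‖ ^ 2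
      ≤ σ / 2 * ‖v - kLazyGD X σ k g (q * k + 1)‖ ^ 2 := by
  have key : ∀ n, n ≤ k → ∑ j ∈ range n, inner ℝ (g (q * k + j + 1))
      (kLazyGD X σ k g (q * k + j + 2)) ≤
      inner ℝ (∑ j ∈ range n, g (q * k + j + 1)) (kLazyGD X σ k g (q * k + n + 1)) + σ / 2 *
        ‖kLazyGD X σ k g (q * k + n + 1) - kLazyGD X σ k g (q * k + 1)‖ ^ 2 := by
    intro n
    induction n with
    | zero => intro _; simp
    | succ n ih =>
      intro hn
      -- Optimality of the current iterate, tested at the next one.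
      have h := proj_three_point hc hX hσ (kLazyGD X σ k g (q * k + 1))
        (∑ j ∈ range n, g (q * k + j + 1)) (kLazyGD_mem (σ := σ) (k := k) (g := g) hX h0
          (q * k + n + 2))
      rw [← kLazyGD_block hX h0 q (by omega : n ≤ k)] at h
      have := ih (by omega)
      rw [sum_range_succ, sum_range_succ, inner_add_left]
      rw [show q * k + (n + 1) + 1 = q * k + n + 2 by ring]
      have : 0 ≤ σ / 2 * ‖kLazyGD X σ k g (q * k + n + 2)
        - kLazyGD X σ k g (q * k + n + 1)‖ ^ 2 := by positivity
      linarith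
  have h := proj_three_point hc hX hσ (kLazyGD X σ k g (q * k + 1))
    (∑ j ∈ range m, g (q * k + j + 1)) hv
  rw [← kLazyGD_block hX h0 q hm] at h
  have h2 := key m hm
  simp only [inner_sub_right, sum_sub_distrib]
  rw [← sum_inner]
  linarith

theorem norm_sub_le_sum_norm_sub (u : ℕ → EuclideanSpace ℝ (Fin d)) (a n : ℕ) :
    ‖u (a + n + 1) - u (a + 1)‖ ≤ ∑ i ∈ range n, ‖u (a + i + 2) - u (a + i + 1)‖ := by
  induction n with
  | zero => simp
  | succ n ih =>
    rw [sum_range_succ]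
    have := norm_sub_le_norm_sub_add_norm_sub (u (a + (n + 1) + 1)) (u (a + n + 1)) (u (a + 1))
    rw [show a + (n + 1) + 1 = a + n + 2 by ring] at *
    linarith

theorem kLazyGD_block_dynamic (hc : Convex ℝ X) (hX : IsCompact X) (h0 : 0 ∈ X) (hσ : 0 < σ)
    {R G : ℝ} (hXR : ∀ x ∈ X, ‖x‖ ≤ R) (hR : 0 ≤ R) (hG : 0 ≤ G) (hk : G * ((k : ℝ) - 1) ≤ 2 * R * σ) {T : ℕ}
    (hg : ∀ t < T, ‖g (t + 1)‖ ≤ G) {u : ℕ → EuclideanSpace ℝ (Fin d)} (hu : ∀ t, u t ∈ X)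
    (q : ℕ) {m : ℕ} (hm : m ≤ k) (hT : q * k + m ≤ T) :
    ∑ j ∈ range m, inner ℝ (g (q * k + j + 1))
        (kLazyGD X σ k g (q * k + j + 2) - u (q * k + j + 1))
      + σ / 2 * ‖u (q * k + m + 1) - kLazyGD X σ k g (q * k + m + 1)‖ ^ 2
      ≤ σ / 2 * ‖u (q * k + 1) - kLazyGD X σ k g (q * k + 1)‖ ^ 2
        + 4 * R * σ * ∑ j ∈ range m, ‖u (q * k + j + 2) - u (q * k + j + 1)‖ := by
  have hs := kLazyGD_block_static (g := g) hc hX h0 hσ q hm (hu (q * k + 1))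
  have hD := norm_sub_le_sum_norm_sub u (q * k) m
  set D := ∑ j ∈ range m, ‖u (q * k + j + 2) - u (q * k + j + 1)‖ with hDdef
  have hD0 : 0 ≤ D := sum_nonneg fun _ _ => norm_nonneg _
  -- Cost of freezing the comparator at the start of the block.
  have hin : ∑ j ∈ range m, inner ℝ (g (q * k + j + 1)) (u (q * k + 1) - u (q * k + j + 1))
      ≤ 2 * R * σ * D := by
    cases m with
    | zero => simpa using by positivity
    | succ n =>
      -- The first round has no drift, so at most `k - 1` rounds count; this is why the slack
      -- condition involves `k - 1` and is free for `k = 1`.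
      rw [sum_range_succ']
      simp only [add_zero, sub_self, inner_zero_right]
      have : ∀ j ∈ range n, inner ℝ (g (q * k + (j + 1) + 1))
          (u (q * k + 1) - u (q * k + (j + 1) + 1)) ≤ G * D := by
        intro j hj
        rw [mem_range] at hj
        refine (real_inner_le_norm _ _).trans
          (mul_le_mul (hg _ (by omega)) ?_ (norm_nonneg _) hG)
        rw [norm_sub_rev]
        refine (norm_sub_le_sum_norm_sub u (q * k) (j + 1)).trans
          (sum_le_sum_of_subset_of_nonneg (range_subset_range.2 (by omega))
            fun _ _ _ => norm_nonneg _)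
      refine (sum_le_card_nsmul _ _ _ this).trans ?_
      rw [card_range, nsmul_eq_mul]
      have hn : (n : ℝ) ≤ k - 1 := by
        have : ((n + 1 : ℕ) : ℝ) ≤ k := by exact_mod_cast hm
        push_cast at this; linarith
      nlinarith [mul_le_mul_of_nonneg_left hn (mul_nonneg hG hD0),
        mul_le_mul_of_nonneg_right hk hD0]
  -- Moving the comparator in the potential: `a² - b² = (a - b)(a + b)` with `a - b ≤ D` and `a, b ≤
  -- 2R`.
  have hsw : ‖u (q * k + m + 1) - kLazyGD X σ k g (q * k + m + 1)‖ ^ 2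
      ≤ ‖u (q * k + 1) - kLazyGD X σ k g (q * k + m + 1)‖ ^ 2 + 4 * R * D := by
    have hp := hXR _ (kLazyGD_mem (σ := σ) (k := k) (g := g) hX h0 (q * k + m + 1))
    set p := kLazyGD X σ k g (q * k + m + 1)
    have h1 := norm_sub_le_norm_sub_add_norm_sub (u (q * k + m + 1)) (u (q * k + 1)) p
    have h2 := (norm_sub_le (u (q * k + m + 1)) p).trans (add_le_add (hXR _ (hu _)) hp)
    have h3 := (norm_sub_le (u (q * k + 1)) p).trans (add_le_add (hXR _ (hu _)) hp)
    nlinarith [norm_nonneg (u (q * k + m + 1) - p), norm_nonneg (u (q * k + 1) - p)]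
  have hsplit : ∑ j ∈ range m, inner ℝ (g (q * k + j + 1))
        (kLazyGD X σ k g (q * k + j + 2) - u (q * k + j + 1)) =
      ∑ j ∈ range m, inner ℝ (g (q * k + j + 1)) (kLazyGD X σ k g (q * k + j + 2) - u (q * k + 1))
      + ∑ j ∈ range m, inner ℝ (g (q * k + j + 1)) (u (q * k + 1) - u (q * k + j + 1)) := by
    rw [← sum_add_distrib]
    refine sum_congr rfl fun j _ => ?_
    rw [← inner_add_right, sub_add_sub_cancel]
  rw [hsplit]
  nlinarith

theorem kLazyGD_lookahead_dynamic (hc : Convex ℝ X) (hX : IsCompact X) (h0 : 0 ∈ X) (hσ : 0 < σ)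
    {R G : ℝ} (hXR : ∀ x ∈ X, ‖x‖ ≤ R) (hR : 0 ≤ R) (hG : 0 ≤ G) (hk : G * ((k : ℝ) - 1) ≤ 2 * R * σ) {T : ℕ}
    (hg : ∀ t < T, ‖g (t + 1)‖ ≤ G) {u : ℕ → EuclideanSpace ℝ (Fin d)} (hu : ∀ t, u t ∈ X)
    (q : ℕ) {m : ℕ} (hm : m ≤ k) (hT : q * k + m ≤ T) :
    ∑ t ∈ range (q * k + m), inner ℝ (g (t + 1)) (kLazyGD X σ k g (t + 2) - u (t + 1))
      + σ / 2 * ‖u (q * k + m + 1) - kLazyGD X σ k g (q * k + m + 1)‖ ^ 2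
      ≤ σ / 2 * R ^ 2
        + 4 * R * σ * ∑ t ∈ range (q * k + m), ‖u (t + 2) - u (t + 1)‖ := by
  induction q generalizing m with
  | zero =>
    have h := kLazyGD_block_dynamic hc hX h0 hσ hXR hR hG hk hg hu 0 hm hT
    simp only [zero_mul, zero_add, kLazyGD_one, sub_zero] at h ⊢
    have : ‖u 1‖ ^ 2 ≤ R ^ 2 := pow_le_pow_left₀ (norm_nonneg _) (hXR _ (hu 1)) 2
    nlinarith
  | succ q ih =>
    have e : (q + 1) * k = q * k + k := by ring
    have h1 := ih le_rfl (by omega)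
    have h2 := kLazyGD_block_dynamic hc hX h0 hσ hXR hR hG hk hg hu (q + 1) hm hT
    rw [sum_range_add, sum_range_add]
    rw [← e] at h1
    linarith

theorem kLazyGD_regret (hc : Convex ℝ X) (hX : IsCompact X) (h0 : 0 ∈ X) (hσ : 0 < σ)
    {R G : ℝ} (hXR : ∀ x ∈ X, ‖x‖ ≤ R) (hR : 0 ≤ R) (hG : 0 ≤ G) (hk1 : 1 ≤ k)
    (hk : G * ((k : ℝ) - 1) ≤ 2 * R * σ) {T : ℕ}
    (hg : ∀ t < T, ‖g (t + 1)‖ ≤ G) {u : ℕ → EuclideanSpace ℝ (Fin d)} (hu : ∀ t, u t ∈ X) :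
    ∑ t ∈ range T, inner ℝ (g (t + 1)) (kLazyGD X σ k g (t + 1) - u (t + 1))
      + ∑ t ∈ range T, ‖kLazyGD X σ k g (t + 1) - kLazyGD X σ k g t‖
      ≤ σ / 2 * R ^ 2 + 4 * R * σ * ∑ t ∈ range T, ‖u (t + 2) - u (t + 1)‖
        + (G ^ 2 + G) * T / σ := by
  have hT : T / k * k + T % k = T := Nat.div_add_mod' T k
  have h := kLazyGD_lookahead_dynamic hc hX h0 hσ hXR hR hG hk hg hu (T / k)
    (Nat.mod_lt T hk1).le hT.le
  rw [hT] at h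
  have hstep : ∀ t < T, ‖kLazyGD X σ k g (t + 2) - kLazyGD X σ k g (t + 1)‖ ≤ G / σ := fun t ht =>
    (norm_kLazyGD_succ_sub_le hc hX h0 hσ hk1 t).trans
      (div_le_div_of_nonneg_right (hg t ht) hσ.le)
  have hswitch : ∑ t ∈ range T, ‖kLazyGD X σ k g (t + 1) - kLazyGD X σ k g t‖ ≤ T * (G / σ) := by
    have : ∀ t ∈ range T, ‖kLazyGD X σ k g (t + 1) - kLazyGD X σ k g t‖ ≤ G / σ := by
      intro t ht
      rw [mem_range] at ht
      cases t with
      | zero => rw [kLazyGD_zero, kLazyGD_one, sub_zero, norm_zero]; positivity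
      | succ t => exact hstep t (by omega)
    simpa using sum_le_card_nsmul _ _ _ this
  have hstab : ∑ t ∈ range T, inner ℝ (g (t + 1)) (kLazyGD X σ k g (t + 1) - u (t + 1)) ≤
      ∑ t ∈ range T, inner ℝ (g (t + 1)) (kLazyGD X σ k g (t + 2) - u (t + 1))
        + T * (G * (G / σ)) := by
    have : ∀ t ∈ range T, inner ℝ (g (t + 1)) (kLazyGD X σ k g (t + 1) - u (t + 1)) ≤
        inner ℝ (g (t + 1)) (kLazyGD X σ k g (t + 2) - u (t + 1)) + G * (G / σ) := by
      intro t ht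
      rw [mem_range] at ht
      rw [← sub_le_iff_le_add', ← inner_sub_right, sub_sub_sub_cancel_right]
      refine (real_inner_le_norm _ _).trans (mul_le_mul (hg t ht) ?_ (norm_nonneg _) hG)
      rw [norm_sub_rev]
      exact hstep t ht
    refine (sum_le_sum this).trans (le_of_eq ?_)
    simp [sum_add_distrib]
  have hpos : 0 ≤ σ / 2 * ‖u (T + 1) - kLazyGD X σ k g (T + 1)‖ ^ 2 := by positivity
  have e : (G ^ 2 + G) * T / σ = T * (G / σ) + T * (G * (G / σ)) := by ring
  rw [e]
  linarith

end Expert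


/-! ### Exponential weights -/

theorem abs_exp_sub_one_le_mul_exp {x a : ℝ} (hx : |x| ≤ a) :
    |Real.exp x - 1| ≤ a * Real.exp a := by
  have hxa := abs_le.1 hx
  have ha : 0 ≤ a := (abs_nonneg x).trans hx
  have h1 : 1 ≤ Real.exp a := Real.one_le_exp ha
  rw [abs_le]
  constructor
  · nlinarith [Real.add_one_le_exp x]
  · have h2 : Real.exp x ≤ Real.exp a := Real.exp_le_exp.2 hxa.2
    have h3 : Real.exp a * Real.exp (-a) = 1 := by rw [← Real.exp_add]; simp
    nlinarith [Real.add_one_le_exp (-a), Real.exp_pos a]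

/-- No smallness of `a` is assumed, so that every horizon `T ≥ 1` is covered; the factor `exp a`
ends up in the constant. -/
theorem exp_le_one_add_add_mul_exp {x a : ℝ} (hx : |x| ≤ a) :
    Real.exp x ≤ 1 + x + a ^ 2 * Real.exp a := by
  have h1 := abs_exp_sub_one_le_mul_exp hx
  have h3 : Real.exp x * Real.exp (-x) = 1 := by rw [← Real.exp_add]; simp
  have h4 : Real.exp x - 1 ≤ x * Real.exp x := by
    nlinarith [Real.add_one_le_exp (-x), Real.exp_pos x]
  have h5 : x * (Real.exp x - 1) ≤ a * (a * Real.exp a) :=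
    (le_abs_self _).trans ((abs_mul _ _).trans_le
      (mul_le_mul hx h1 (abs_nonneg _) ((abs_nonneg x).trans hx)))
  nlinarith

section Hedge

variable {N : ℕ} {α L : ℝ} {w ℓ : ℕ → ℝ}

theorem hedge_partition_pos (hw : ∀ i ∈ Icc 1 N, 0 < w i) (hs : ∑ i ∈ Icc 1 N, w i = 1) :
    0 < ∑ j ∈ Icc 1 N, w j * Real.exp (-α * ℓ j) := by
  refine sum_pos (fun i hi => mul_pos (hw i hi) (Real.exp_pos _)) ?_
  by_contra h
  rw [not_nonempty_iff_eq_empty.1 h] at hs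
  simp at hs

theorem hedgeUpdate_pos (hw : ∀ i ∈ Icc 1 N, 0 < w i) (hs : ∑ i ∈ Icc 1 N, w i = 1)
    {i : ℕ} (hi : i ∈ Icc 1 N) : 0 < hedgeUpdate N α w ℓ i :=
  div_pos (mul_pos (hw i hi) (Real.exp_pos _)) (hedge_partition_pos hw hs)

theorem sum_hedgeUpdate (hw : ∀ i ∈ Icc 1 N, 0 < w i) (hs : ∑ i ∈ Icc 1 N, w i = 1) :
    ∑ i ∈ Icc 1 N, hedgeUpdate N α w ℓ i = 1 := by
  simp only [hedgeUpdate]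
  rw [← sum_div, div_self (hedge_partition_pos hw hs).ne']

theorem abs_neg_mul_le (hα : 0 ≤ α) {x : ℝ} (hx : |x| ≤ L) : |-α * x| ≤ α * L := by
  rw [abs_mul, abs_neg, abs_of_nonneg hα]
  exact mul_le_mul_of_nonneg_left hx hα

theorem le_log_hedgeUpdate (hα : 0 ≤ α) (hw : ∀ i ∈ Icc 1 N, 0 < w i)
    (hs : ∑ i ∈ Icc 1 N, w i = 1) (hℓ : ∀ i ∈ Icc 1 N, |ℓ i| ≤ L) {i : ℕ} (hi : i ∈ Icc 1 N) :
    Real.log (w i) + α * (∑ j ∈ Icc 1 N, w j * ℓ j - ℓ i) - (α * L) ^ 2 * Real.exp (α * L)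
      ≤ Real.log (hedgeUpdate N α w ℓ i) := by
  have hZ := hedge_partition_pos (α := α) (ℓ := ℓ) hw hs
  rw [hedgeUpdate, Real.log_div (mul_pos (hw i hi) (Real.exp_pos _)).ne' hZ.ne',
    Real.log_mul (hw i hi).ne' (Real.exp_pos _).ne', Real.log_exp]
  have h1 := Real.log_le_sub_one_of_pos hZ
  have h2 : ∑ j ∈ Icc 1 N, w j * Real.exp (-α * ℓ j) ≤
      ∑ j ∈ Icc 1 N, (w j + -α * (w j * ℓ j) + w j * ((α * L) ^ 2 * Real.exp (α * L))) := by
    refine sum_le_sum fun j hj => ?_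
    have := mul_le_mul_of_nonneg_left
      (exp_le_one_add_add_mul_exp (abs_neg_mul_le hα (hℓ j hj))) (hw j hj).le
    linarith
  rw [sum_add_distrib, sum_add_distrib, ← sum_mul, ← mul_sum, hs] at h2
  linarith

/-- Each weight is multiplied by `exp (-α * ℓ i - log Z)`. The partition function `Z` lies between
`exp (-αL)` and `exp (αL)`, so the exponent is at most `2αL` in absolute value. -/
theorem sum_abs_hedgeUpdate_sub_le (hα : 0 ≤ α) (hw : ∀ i ∈ Icc 1 N, 0 < w i)
    (hs : ∑ i ∈ Icc 1 N, w i = 1) (hℓ : ∀ i ∈ Icc 1 N, |ℓ i| ≤ L) :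
    ∑ i ∈ Icc 1 N, |hedgeUpdate N α w ℓ i - w i| ≤ 2 * (α * L) * Real.exp (2 * (α * L)) := by
  have hZ := hedge_partition_pos (α := α) (ℓ := ℓ) hw hs
  set Z := ∑ j ∈ Icc 1 N, w j * Real.exp (-α * ℓ j) with hZdef
  have hlog : |Real.log Z| ≤ α * L := by
    rw [abs_le]
    constructor
    · rw [Real.le_log_iff_exp_le hZ, hZdef, ← one_mul (Real.exp _), ← hs, sum_mul]
      exact sum_le_sum fun j hj => mul_le_mul_of_nonneg_left
        (Real.exp_le_exp.2 (abs_le.1 (abs_neg_mul_le hα (hℓ j hj))).1) (hw j hj).le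
    · rw [Real.log_le_iff_le_exp hZ, hZdef, ← one_mul (Real.exp _), ← hs, sum_mul]
      exact sum_le_sum fun j hj => mul_le_mul_of_nonneg_left
        (Real.exp_le_exp.2 (abs_le.1 (abs_neg_mul_le hα (hℓ j hj))).2) (hw j hj).le
  have h : ∀ i ∈ Icc 1 N, |hedgeUpdate N α w ℓ i - w i| ≤
      w i * (2 * (α * L) * Real.exp (2 * (α * L))) := by
    intro i hi
    have e : hedgeUpdate N α w ℓ i - w i = w i * (Real.exp (-α * ℓ i - Real.log Z) - 1) := by
      rw [hedgeUpdate, Real.exp_sub, Real.exp_log hZ]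
      ring
    rw [e, abs_mul, abs_of_pos (hw i hi)]
    refine mul_le_mul_of_nonneg_left (abs_exp_sub_one_le_mul_exp ?_) (hw i hi).le
    have := abs_sub (-α * ℓ i) (Real.log Z)
    linarith [abs_neg_mul_le hα (hℓ i hi)]
  refine (sum_le_sum h).trans (le_of_eq ?_)
  rw [← sum_mul, hs, one_mul]

end Hedge

theorem sum_initial_weight {N : ℕ} (hN : 1 ≤ N) :
    ∑ i ∈ Icc 1 N, (1 + 1 / (N : ℝ)) / ((i : ℝ) * ((i : ℝ) + 1)) = 1 := by
  have h : ∀ n : ℕ, ∑ i ∈ Icc 1 n, 1 / ((i : ℝ) * ((i : ℝ) + 1)) = n / (n + 1) := by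
    intro n
    induction n with
    | zero => simp
    | succ n ih =>
      rw [sum_Icc_succ_top (by omega), ih]
      push_cast
      field_simp
      ring
  have hN' : (0 : ℝ) < N := by exact_mod_cast hN
  simp only [div_eq_mul_one_div (1 + 1 / (N : ℝ))]
  rw [← mul_sum, h]
  field_simp

/-! ### The meta-learner against a single expert -/

section Sader

variable {d N : ℕ} {α : ℝ} {y : ℕ → ℕ → EuclideanSpace ℝ (Fin d)}
  {g : ℕ → EuclideanSpace ℝ (Fin d)}

theorem saderWeight_pos_and_sum (hN : 1 ≤ N) (t : ℕ) :
    (∀ i ∈ Icc 1 N, 0 < saderWeight N α y g (t + 1) i) ∧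
      ∑ i ∈ Icc 1 N, saderWeight N α y g (t + 1) i = 1 := by
  induction t with
  | zero =>
    simp only [saderWeight]
    refine ⟨fun i hi => ?_, sum_initial_weight hN⟩
    have : (0 : ℝ) < i := by exact_mod_cast (mem_Icc.1 hi).1
    positivity
  | succ t ih =>
    simp only [saderWeight]
    exact ⟨fun i hi => hedgeUpdate_pos ih.1 ih.2 hi, sum_hedgeUpdate ih.1 ih.2⟩

theorem norm_average_le {w : ℕ → ℝ} {x : ℕ → EuclideanSpace ℝ (Fin d)} {R : ℝ}
    (hw : ∀ i ∈ Icc 1 N, 0 ≤ w i) (hs : ∑ i ∈ Icc 1 N, w i = 1)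
    (hx : ∀ i ∈ Icc 1 N, ‖x i‖ ≤ R) : ‖average N w x‖ ≤ R := by
  refine (norm_sum_le _ _).trans ?_
  rw [← one_mul R, ← hs, sum_mul]
  refine sum_le_sum fun i hi => ?_
  rw [norm_smul, Real.norm_of_nonneg (hw i hi)]
  exact mul_le_mul_of_nonneg_left (hx i hi) (hw i hi)

/-- The new weights multiply the expert movements, to match the mean meta-loss of the next round. -/
theorem norm_average_sub_average_le {w w' : ℕ → ℝ} {x x' : ℕ → EuclideanSpace ℝ (Fin d)} {R : ℝ}
    (hw' : ∀ i ∈ Icc 1 N, 0 ≤ w' i) (hx : ∀ i ∈ Icc 1 N, ‖x i‖ ≤ R) :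
    ‖average N w' x' - average N w x‖ ≤
      ∑ i ∈ Icc 1 N, w' i * ‖x' i - x i‖ + R * ∑ i ∈ Icc 1 N, |w' i - w i| := by
  rw [average, average, ← sum_sub_distrib, mul_sum, ← sum_add_distrib]
  refine (norm_sum_le _ _).trans (sum_le_sum fun i hi => ?_)
  have e : w' i • x' i - w i • x i = w' i • (x' i - x i) + (w' i - w i) • x i := by
    rw [smul_sub, sub_smul]; abel
  rw [e]
  refine (norm_add_le _ _).trans ?_
  rw [norm_smul, norm_smul, Real.norm_of_nonneg (hw' i hi), Real.norm_eq_abs]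
  have := mul_le_mul_of_nonneg_left (hx i hi) (abs_nonneg (w' i - w i))
  linarith

/-- The meta-loss of expert `i` in round `t + 1`. -/
noncomputable def saderLoss (N : ℕ) (α : ℝ) (y : ℕ → ℕ → EuclideanSpace ℝ (Fin d))
    (g : ℕ → EuclideanSpace ℝ (Fin d)) (t i : ℕ) : ℝ :=
  inner ℝ (g (t + 1)) (y i (t + 1) - saderDecision N α y g (t + 1)) + ‖y i (t + 1) - y i t‖

theorem saderWeight_succ (t : ℕ) : saderWeight N α y g (t + 2) =
    hedgeUpdate N α (saderWeight N α y g (t + 1)) (saderLoss N α y g t) := by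
  rw [saderWeight]
  rfl

/-- The learner's decision is the weighted mean of the experts, so the linear parts cancel. -/
theorem sum_saderWeight_mul_loss (hN : 1 ≤ N) (t : ℕ) :
    ∑ i ∈ Icc 1 N, saderWeight N α y g (t + 1) i * saderLoss N α y g t i =
      ∑ i ∈ Icc 1 N, saderWeight N α y g (t + 1) i * ‖y i (t + 1) - y i t‖ := by
  simp only [saderLoss, mul_add, sum_add_distrib, inner_sub_right, mul_sub, sum_sub_distrib]
  rw [← sum_mul, (saderWeight_pos_and_sum hN t).2, saderDecision, average, inner_sum]
  simp [inner_smul_right]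

theorem abs_saderLoss_le (hN : 1 ≤ N) {R G : ℝ} (hy : ∀ i ∈ Icc 1 N, ∀ t, ‖y i t‖ ≤ R) {t : ℕ}
    (hg : ‖g (t + 1)‖ ≤ G) {i : ℕ} (hi : i ∈ Icc 1 N) :
    |saderLoss N α y g t i| ≤ 2 * R * (G + 1) := by
  obtain ⟨hw, hs⟩ := saderWeight_pos_and_sum (α := α) (y := y) (g := g) hN t
  have hx : ‖saderDecision N α y g (t + 1)‖ ≤ R :=
    norm_average_le (fun i hi => (hw i hi).le) hs fun i hi => hy i hi _
  have h1 := abs_real_inner_le_norm (g (t + 1)) (y i (t + 1) - saderDecision N α y g (t + 1))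
  have h2 := (norm_sub_le (y i (t + 1)) (saderDecision N α y g (t + 1))).trans
    (add_le_add (hy i hi _) hx)
  have h3 := (norm_sub_le (y i (t + 1)) (y i t)).trans (add_le_add (hy i hi _) (hy i hi _))
  have h4 := mul_le_mul hg h2 (norm_nonneg _) ((norm_nonneg _).trans hg)
  refine (abs_add_le _ _).trans ?_
  rw [abs_norm]
  linarith

/-- Deliberately crude: `2 ^ (i - 1)` has the order of `√(P + 1)` for the expert finally chosen. -/
theorem log_initial_weight_le {i : ℕ} (hi : i ∈ Icc 1 N) :
    -Real.log (saderWeight N α y g 1 i) ≤ 2 * 2 ^ (i - 1) := by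
  obtain ⟨h1, h2⟩ := mem_Icc.1 hi
  have hi0 : (0 : ℝ) < i := by exact_mod_cast h1
  have hN0 : (0 : ℝ) < N := by exact_mod_cast h1.trans h2
  simp only [saderWeight]
  rw [Real.log_div (by positivity) (by positivity), Real.log_mul (by positivity) (by positivity)]
  have h3 : 0 ≤ Real.log (1 + 1 / (N : ℝ)) := Real.log_nonneg (by simp)
  have h4 := Real.log_le_sub_one_of_pos hi0
  have h5 := Real.log_le_sub_one_of_pos (show (0 : ℝ) < i + 1 by positivity)
  have h6 : (i : ℝ) ≤ 2 ^ (i - 1) := by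
    have : i ≤ 2 ^ (i - 1) := by
      have := Nat.lt_two_pow_self (n := i - 1)
      omega
    exact_mod_cast this
  linarith

theorem sader_hedge_regret (hN : 1 ≤ N) (hα : 0 < α) {R G : ℝ}
    (hy : ∀ i ∈ Icc 1 N, ∀ t, ‖y i t‖ ≤ R) {T : ℕ} (hg : ∀ t < T, ‖g (t + 1)‖ ≤ G) {i : ℕ}
    (hi : i ∈ Icc 1 N) :
    ∑ t ∈ range T, (∑ j ∈ Icc 1 N, saderWeight N α y g (t + 1) j * saderLoss N α y g t j
        - saderLoss N α y g t i) ≤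
      2 * 2 ^ (i - 1) / α
        + T * (α * (2 * R * (G + 1)) ^ 2 * Real.exp (α * (2 * R * (G + 1)))) := by
  set L := 2 * R * (G + 1)
  -- The potential is the log-weight of expert `i`, which never exceeds `0`.
  have key : ∀ n ≤ T, Real.log (saderWeight N α y g 1 i)
      + α * ∑ t ∈ range n, (∑ j ∈ Icc 1 N, saderWeight N α y g (t + 1) j * saderLoss N α y g t j
        - saderLoss N α y g t i) - n * ((α * L) ^ 2 * Real.exp (α * L)) ≤
      Real.log (saderWeight N α y g (n + 1) i) := by
    intro n
    induction n with
    | zero => intro _; simp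
    | succ n ih =>
      intro hn
      obtain ⟨hw, hs⟩ := saderWeight_pos_and_sum (α := α) (y := y) (g := g) hN n
      have h := le_log_hedgeUpdate hα.le hw hs
        (fun j hj => abs_saderLoss_le (α := α) hN hy (hg n hn) hj) hi
      rw [← saderWeight_succ] at h
      have := ih (by omega)
      rw [sum_range_succ, mul_add]
      push_cast
      linarith
  obtain ⟨hw, hs⟩ := saderWeight_pos_and_sum (α := α) (y := y) (g := g) hN T
  have hle : saderWeight N α y g (T + 1) i ≤ 1 := by
    rw [← hs]
    exact single_le_sum (f := saderWeight N α y g (T + 1)) (fun j hj => (hw j hj).le) hi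
  have h1 := Real.log_nonpos (hw i hi).le hle
  have h2 := key T le_rfl
  have h3 := log_initial_weight_le (α := α) (y := y) (g := g) hi
  refine le_of_mul_le_mul_left ?_ hα
  have e : α * (2 * 2 ^ (i - 1) / α + T * (α * L ^ 2 * Real.exp (α * L))) =
      2 * 2 ^ (i - 1) + T * ((α * L) ^ 2 * Real.exp (α * L)) := by
    field_simp
  rw [e]
  linarith

theorem sader_switching_le (hN : 1 ≤ N) (hα : 0 < α) {R G : ℝ} (hR : 0 ≤ R)
    (hy : ∀ i ∈ Icc 1 N, ∀ t, ‖y i t‖ ≤ R) {T : ℕ} (hg : ∀ t < T, ‖g (t + 1)‖ ≤ G) :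
    ∑ t ∈ range T, ‖saderDecision N α y g (t + 2) - saderDecision N α y g (t + 1)‖ ≤
      ∑ t ∈ range (T + 1),
        ∑ j ∈ Icc 1 N, saderWeight N α y g (t + 1) j * ‖y j (t + 1) - y j t‖
      + T * (R * (2 * (α * (2 * R * (G + 1))) * Real.exp (2 * (α * (2 * R * (G + 1)))))) := by
  have h : ∀ t ∈ range T, ‖saderDecision N α y g (t + 2) - saderDecision N α y g (t + 1)‖ ≤
      ∑ j ∈ Icc 1 N, saderWeight N α y g (t + 2) j * ‖y j (t + 2) - y j (t + 1)‖
      + R * (2 * (α * (2 * R * (G + 1))) * Real.exp (2 * (α * (2 * R * (G + 1))))) := by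
    intro t ht
    rw [mem_range] at ht
    obtain ⟨hw, hs⟩ := saderWeight_pos_and_sum (α := α) (y := y) (g := g) hN t
    obtain ⟨hw', _⟩ := saderWeight_pos_and_sum (α := α) (y := y) (g := g) hN (t + 1)
    refine (norm_average_sub_average_le (fun i hi => (hw' i hi).le)
      fun i hi => hy i hi (t + 1)).trans (add_le_add le_rfl (mul_le_mul_of_nonneg_left ?_ hR))
    rw [saderWeight_succ]
    exact sum_abs_hedgeUpdate_sub_le hα.le hw hs
      fun j hj => abs_saderLoss_le (α := α) hN hy (hg t ht) hj
  refine (sum_le_sum h).trans ?_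
  rw [sum_add_distrib, sum_range_succ' _ T, sum_const, card_range, nsmul_eq_mul]
  obtain ⟨hw, _⟩ := saderWeight_pos_and_sum (α := α) (y := y) (g := g) hN 0
  have : 0 ≤ ∑ j ∈ Icc 1 N, saderWeight N α y g (0 + 1) j * ‖y j (0 + 1) - y j 0‖ :=
    sum_nonneg fun j hj => mul_nonneg (hw j hj).le (norm_nonneg _)
  have e : ∀ t, t + 1 + 1 = t + 2 := fun _ => rfl
  simp only [e]
  linarith

/-- SAder is competitive with every expert, up to a meta-regret. -/
theorem sader_meta_regret (hN : 1 ≤ N) (hα : 0 < α) {R G : ℝ} (hR : 0 ≤ R) (hG : 0 ≤ G)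
    (hy : ∀ i ∈ Icc 1 N, ∀ t, ‖y i t‖ ≤ R) {T : ℕ} (hT : 1 ≤ T)
    (hg : ∀ t < T, ‖g (t + 1)‖ ≤ G) {i : ℕ} (hi : i ∈ Icc 1 N)
    (u : ℕ → EuclideanSpace ℝ (Fin d)) :
    ∑ t ∈ range T, inner ℝ (g (t + 1)) (saderDecision N α y g (t + 1) - u (t + 1))
      + ∑ t ∈ range (T - 1), ‖saderDecision N α y g (t + 2) - saderDecision N α y g (t + 1)‖ ≤
    ∑ t ∈ range T, inner ℝ (g (t + 1)) (y i (t + 1) - u (t + 1))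
      + ∑ t ∈ range T, ‖y i (t + 1) - y i t‖ + 2 * 2 ^ (i - 1) / α
      + T * (α * (2 * R * (G + 1)) ^ 2 * Real.exp (α * (2 * R * (G + 1))))
      + T * (R * (2 * (α * (2 * R * (G + 1))) * Real.exp (2 * (α * (2 * R * (G + 1)))))) := by
  -- Only `T - 1` switches are counted, so the last one uses the weights of round `T`, still covered
  -- by the Hedge bound.
  obtain ⟨n, rfl⟩ : ∃ n, T = n + 1 := ⟨T - 1, by omega⟩
  have h1 := sader_hedge_regret hN hα hy hg hi
  have h2 := sader_switching_le hN hα hR hy (T := n) fun t ht => hg t (by omega)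
  simp only [sum_saderWeight_mul_loss hN, sum_sub_distrib] at h1
  have h3 : ∑ t ∈ range (n + 1), saderLoss N α y g t i =
      ∑ t ∈ range (n + 1), inner ℝ (g (t + 1)) (y i (t + 1) - u (t + 1))
      - ∑ t ∈ range (n + 1), inner ℝ (g (t + 1)) (saderDecision N α y g (t + 1) - u (t + 1))
      + ∑ t ∈ range (n + 1), ‖y i (t + 1) - y i t‖ := by
    rw [← sum_sub_distrib, ← sum_add_distrib]
    refine sum_congr rfl fun t _ => ?_
    rw [← inner_sub_right, sub_sub_sub_cancel_right, saderLoss]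
  have h4 : 0 ≤ R * (2 * (α * (2 * R * (G + 1))) * Real.exp (2 * (α * (2 * R * (G + 1))))) := by
    positivity
  rw [Nat.add_sub_cancel]
  push_cast at h1 ⊢
  linarith

end Sader


/-! ### The grid, the ensemble bound and its tuning -/

theorem sum_Icc_one (f : ℕ → ℝ) (n : ℕ) : ∑ t ∈ Icc 1 n, f t = ∑ t ∈ range n, f (t + 1) := by
  induction n with
  | zero => simp
  | succ n ih => rw [sum_range_succ, ← ih, sum_Icc_succ_top (by omega)]

theorem mul_slack_sub_one_le {R G σ : ℝ} (hR : 0 < R) (hG : 0 < G) (hσ : 0 < σ) :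
    G * ((slack R G σ : ℝ) - 1) ≤ 2 * R * σ := by
  have h : (slack R G σ : ℝ) - 1 ≤ 2 * R / G * σ := by
    have hpos : 0 ≤ 2 * R / G * σ := by positivity
    have h1 := Nat.floor_le hpos
    rw [slack, Nat.cast_max, Nat.cast_one, sub_le_iff_le_add]
    exact max_le (by linarith) (by linarith)
  calc G * ((slack R G σ : ℝ) - 1) ≤ G * (2 * R / G * σ) := mul_le_mul_of_nonneg_left h hG.le
    _ = 2 * R * σ := by field_simp

/-- The grid of powers of two below `2 ^ (gridSize T - 1)` contains a point matching `q` up to a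
factor `2`. -/
theorem exists_grid_index {T : ℕ} (hT : 1 ≤ T) {q : ℝ} (hq1 : 1 ≤ q)
    (hq : q ^ 2 ≤ 8 * (T : ℝ) - 7) :
    ∃ i ∈ Icc 1 (gridSize T), q ≤ 2 ^ (i - 1) ∧ (2 : ℝ) ^ (i - 1) ≤ 2 * q := by
  classical
  have hT' : (1 : ℝ) ≤ T := by exact_mod_cast hT
  have hpos : 0 < 8 * (T : ℝ) - 7 := by linarith
  have hN : q ≤ 2 ^ ⌈(1 / 2 : ℝ) * Real.logb 2 (8 * (T : ℝ) - 7)⌉₊ := by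
    have h1 := Nat.le_ceil ((1 / 2 : ℝ) * Real.logb 2 (8 * (T : ℝ) - 7))
    set n := ⌈(1 / 2 : ℝ) * Real.logb 2 (8 * (T : ℝ) - 7)⌉₊
    have h2 : Real.logb 2 (8 * (T : ℝ) - 7) ≤ (2 * n : ℕ) := by push_cast; linarith
    rw [Real.logb_le_iff_le_rpow one_lt_two hpos, Real.rpow_natCast, mul_comm 2 n, pow_mul] at h2
    exact le_of_sq_le_sq (hq.trans h2) (by positivity)
  have hex : ∃ n : ℕ, q ≤ 2 ^ n := ⟨_, hN⟩
  -- The least power of two above `q`: it is either `1`, or its half is below `q`.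
  refine ⟨Nat.find hex + 1, mem_Icc.2 ⟨by omega, Nat.succ_le_succ (Nat.find_min' hex hN)⟩,
    Nat.find_spec hex, ?_⟩
  rw [Nat.add_sub_cancel]
  rcases Nat.eq_zero_or_pos (Nat.find hex) with h | h
  · rw [h]; linarith
  · obtain ⟨m, hm⟩ := Nat.exists_eq_succ_of_ne_zero h.ne'
    have := Nat.find_min hex (show m < Nat.find hex by omega)
    rw [hm, pow_succ]
    linarith

theorem pathLength_le {d T : ℕ} {u : ℕ → EuclideanSpace ℝ (Fin d)} {R : ℝ}
    (hT : 1 ≤ T) (hu : ∀ t ∈ Icc 1 T, ‖u t‖ ≤ R) : pathLength T u ≤ 2 * R * (T - 1) := by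
  have h : ∀ t ∈ Icc 1 (T - 1), ‖u (t + 1) - u t‖ ≤ 2 * R := by
    intro t ht
    rw [mem_Icc] at ht
    have := (norm_sub_le (u (t + 1)) (u t)).trans (add_le_add
      (hu _ (mem_Icc.2 ⟨by omega, by omega⟩)) (hu _ (mem_Icc.2 ⟨by omega, by omega⟩)))
    linarith
  refine (sum_le_card_nsmul _ _ _ h).trans (le_of_eq ?_)
  rw [Nat.card_Icc, nsmul_eq_mul, Nat.add_sub_cancel, Nat.cast_sub hT]
  push_cast
  ring

theorem sum_range_clamped_eq_pathLength {d T : ℕ} (hT : 1 ≤ T)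
    (u : ℕ → EuclideanSpace ℝ (Fin d)) :
    ∑ t ∈ range T, ‖u (max 1 (min (t + 2) T)) - u (max 1 (min (t + 1) T))‖ = pathLength T u := by
  obtain ⟨n, rfl⟩ : ∃ n, T = n + 1 := ⟨T - 1, by omega⟩
  rw [pathLength, Nat.add_sub_cancel, sum_Icc_one, sum_range_succ]
  rw [show max 1 (min (n + 2) (n + 1)) = n + 1 by omega,
    show max 1 (min (n + 1) (n + 1)) = n + 1 by omega, sub_self, norm_zero, add_zero]
  refine sum_congr rfl fun t ht => ?_
  rw [mem_range] at ht
  rw [show max 1 (min (t + 2) (n + 1)) = t + 1 + 1 by omega,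
    show max 1 (min (t + 1) (n + 1)) = t + 1 by omega]

/-- Regret of the ensemble against any comparator sequence, in terms of any expert of the grid. -/
theorem ensemble_regret_le {R G : ℝ} (hR : 0 < R) (hG : 0 < G) {d T : ℕ}
    {X : Set (EuclideanSpace ℝ (Fin d))} (hT : 1 ≤ T) (hc : Convex ℝ X) (hX : IsCompact X)
    (h0 : 0 ∈ X) (hXR : ∀ x ∈ X, ‖x‖ ≤ R) {f : ℕ → EuclideanSpace ℝ (Fin d) → ℝ}
    {g : ℕ → EuclideanSpace ℝ (Fin d)}
    (hsub : ∀ t ∈ Icc 1 T, IsSubgradientOn X (f t) (ensemble R G T X g t) (g t))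
    (hg : ∀ t ∈ Icc 1 T, ‖g t‖ ≤ G) {u : ℕ → EuclideanSpace ℝ (Fin d)}
    (hu : ∀ t ∈ Icc 1 T, u t ∈ X) {i : ℕ} (hi : i ∈ Icc 1 (gridSize T)) {σ α L : ℝ}
    (hσ : σ = gridSigma R G T i) (hσ0 : 0 < σ) (hα : α = metaStep R G T) (hα0 : 0 < α)
    (hL : L = 2 * R * (G + 1)) :
    regret T f (ensemble R G T X g) u ≤
      σ / 2 * R ^ 2 + 4 * R * σ * pathLength T u + (G ^ 2 + G) * T / σ + 2 * 2 ^ (i - 1) / α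
      + T * (α * L ^ 2 * Real.exp (α * L))
      + T * (R * (2 * (α * L) * Real.exp (2 * (α * L)))) := by
  have hg' : ∀ t < T, ‖g (t + 1)‖ ≤ G := fun t ht => hg _ (mem_Icc.2 ⟨by omega, by omega⟩)
  -- Clamping the time index to `[1, T]` keeps the comparator in `X` at all times; the extra step
  -- from `T` to `T + 1` has length zero.
  set v : ℕ → EuclideanSpace ℝ (Fin d) := fun t => u (max 1 (min t T)) with hv
  have hvX : ∀ t, v t ∈ X := fun t => hu _ (mem_Icc.2 ⟨by omega, by omega⟩)
  have hvu : ∀ t < T, v (t + 1) = u (t + 1) := fun t ht => by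
    rw [hv]; simp only; rw [show max 1 (min (t + 1) T) = t + 1 by omega]
  set y : ℕ → ℕ → EuclideanSpace ℝ (Fin d) := fun i =>
    kLazyGD X (gridSigma R G T i) (slack R G (gridSigma R G T i)) g with hy
  have hyR : ∀ j ∈ Icc 1 (gridSize T), ∀ t, ‖y j t‖ ≤ R :=
    fun j _ t => hXR _ (kLazyGD_mem hX h0 t)
  have hmeta := sader_meta_regret (N := gridSize T) (α := α) (y := y) (g := g) (Nat.le_add_left 1 _) hα0 hR.le hG.le
    hyR hT hg' hi v
  have hexp := kLazyGD_regret (g := g) hc hX h0 hσ0 hXR hR.le hG.le (k := slack R G σ)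
    (le_max_left _ _) (mul_slack_sub_one_le hR hG hσ0) hg' hvX
  have hpath := sum_range_clamped_eq_pathLength hT u
  rw [hσ] at hexp
  simp only [hv, hpath] at hexp
  rw [← hL] at hmeta
  have hlin : ∑ t ∈ Icc 1 T, (f t (ensemble R G T X g t) - f t (u t)) ≤
      ∑ t ∈ range T, inner ℝ (g (t + 1))
        (saderDecision (gridSize T) α y g (t + 1) - v (t + 1)) := by
    rw [sum_Icc_one]
    refine sum_le_sum fun t ht => ?_
    rw [mem_range] at ht
    have hmem : t + 1 ∈ Icc 1 T := mem_Icc.2 ⟨by omega, by omega⟩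
    have h := hsub _ hmem _ (hu _ hmem)
    rw [hvu t ht, ← neg_sub (u (t + 1)), inner_neg_right, hα]
    change _ ≤ -inner ℝ (g (t + 1)) (u (t + 1) - ensemble R G T X g (t + 1))
    linarith
  have hsw : ∑ t ∈ Icc 1 (T - 1), ‖ensemble R G T X g (t + 1) - ensemble R G T X g t‖ =
      ∑ t ∈ range (T - 1), ‖saderDecision (gridSize T) α y g (t + 2)
        - saderDecision (gridSize T) α y g (t + 1)‖ := by
    rw [sum_Icc_one, hα]
    rfl
  rw [regret, hsw]
  simp only [hv, hy] at hmeta hlin ⊢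
  rw [hσ]
  linarith

/-- The regret bound of `ensemble_regret_le` under a tuning `K ≈ Q` of the expert and `S = √T`. -/
theorem tuned_bound_le {R G b κ L S K Q P r₁ r₂ : ℝ} (hR : 0 < R) (hG : 0 < G) (hb0 : 0 < b)
    (hκ0 : 0 < κ) (hL0 : 0 < L) (hS1 : 1 ≤ S) (hK0 : 0 < K) (hQ1 : 1 ≤ Q) (hP0 : 0 ≤ P)
    (hQ2 : Q ^ 2 = P + 1) (hr1 : Q ≤ r₁ * K) (hr2 : K ≤ 2 * r₂ * Q) :
    b * S / K / 2 * R ^ 2 + 4 * R * (b * S / K) * P + (G ^ 2 + G) * S ^ 2 / (b * S / K)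
      + 2 * K / (κ / S) + S ^ 2 * (κ / S * L ^ 2 * Real.exp (κ / S * L))
      + S ^ 2 * (R * (2 * (κ / S * L) * Real.exp (2 * (κ / S * L)))) ≤
    (b * (R ^ 2 / 2 + 4 * R) * r₁ + (G ^ 2 + G) * (2 * r₂) / b
      + 4 * r₂ / κ + κ * L ^ 2 * Real.exp (κ * L)
      + R * (2 * (κ * L) * Real.exp (2 * (κ * L)))) * (S * Q) := by
  have hS0 : 0 < S := by linarith
  have e1 : b * S / K / 2 * R ^ 2 + 4 * R * (b * S / K) * P ≤
      b * (R ^ 2 / 2 + 4 * R) * r₁ * (S * Q) := by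
    have h1 : R ^ 2 / 2 + 4 * R * P ≤ (R ^ 2 / 2 + 4 * R) * Q ^ 2 := by
      rw [hQ2]; nlinarith [mul_nonneg (sq_nonneg R) hP0]
    have h2 : Q ^ 2 / K ≤ r₁ * Q := by
      rw [div_le_iff₀ hK0]; nlinarith
    calc _ = b * S / K * (R ^ 2 / 2 + 4 * R * P) := by ring
      _ ≤ b * S / K * ((R ^ 2 / 2 + 4 * R) * Q ^ 2) :=
        mul_le_mul_of_nonneg_left h1 (by positivity)
      _ = b * S * (R ^ 2 / 2 + 4 * R) * (Q ^ 2 / K) := by ring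
      _ ≤ b * S * (R ^ 2 / 2 + 4 * R) * (r₁ * Q) :=
        mul_le_mul_of_nonneg_left h2 (by positivity)
      _ = _ := by ring
  have e2 : (G ^ 2 + G) * S ^ 2 / (b * S / K) ≤
      (G ^ 2 + G) * (2 * r₂) / b * (S * Q) := by
    calc _ = (G ^ 2 + G) * S / b * K := by field_simp
      _ ≤ (G ^ 2 + G) * S / b * (2 * r₂ * Q) :=
        mul_le_mul_of_nonneg_left hr2 (by positivity)
      _ = _ := by ring
  have e3 : 2 * K / (κ / S) ≤ 4 * r₂ / κ * (S * Q) := by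
    calc _ = 2 * S / κ * K := by field_simp
      _ ≤ 2 * S / κ * (2 * r₂ * Q) :=
        mul_le_mul_of_nonneg_left hr2 (by positivity)
      _ = _ := by ring
  -- Since `S ≥ 1`, the exponential factors are bounded independently of `T`.
  have hκS : κ / S * L ≤ κ * L :=
    mul_le_mul_of_nonneg_right (div_le_self hκ0.le hS1) hL0.le
  have hSQ : S ≤ S * Q := le_mul_of_one_le_right hS0.le hQ1
  have e4 : S ^ 2 * (κ / S * L ^ 2 * Real.exp (κ / S * L)) ≤
      κ * L ^ 2 * Real.exp (κ * L) * (S * Q) := by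
    calc _ = κ * L ^ 2 * Real.exp (κ / S * L) * S := by field_simp
      _ ≤ κ * L ^ 2 * Real.exp (κ * L) * (S * Q) := by gcongr
  have e5 : S ^ 2 * (R * (2 * (κ / S * L) * Real.exp (2 * (κ / S * L)))) ≤
      R * (2 * (κ * L) * Real.exp (2 * (κ * L))) * (S * Q) := by
    calc _ = R * (2 * (κ * L) * Real.exp (2 * (κ / S * L))) * S := by field_simp
      _ ≤ R * (2 * (κ * L) * Real.exp (2 * (κ * L))) * (S * Q) := by gcongr
  linarith

end PartialLazy

theorem theorem8 (R G : ℝ) (hR : 0 < R) (hG : 0 < G) :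
    ∃ c : ℝ, ∀ (d T : ℕ) (X : Set (EuclideanSpace ℝ (Fin d))),
      1 ≤ T → Convex ℝ X → IsCompact X → 0 ∈ X → X ⊆ Metric.closedBall 0 R →
      ∀ (f : ℕ → EuclideanSpace ℝ (Fin d) → ℝ) (g : ℕ → EuclideanSpace ℝ (Fin d)),
        (∀ t ∈ Finset.Icc 1 T, ConvexOn ℝ X (f t)) →
        (∀ t ∈ Finset.Icc 1 T,
          PartialLazy.IsSubgradientOn X (f t) (PartialLazy.ensemble R G T X g t) (g t)) →
        (∀ t ∈ Finset.Icc 1 T, ‖g t‖ ≤ G) →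
        ∀ u : ℕ → EuclideanSpace ℝ (Fin d), (∀ t ∈ Finset.Icc 1 T, u t ∈ X) →
          PartialLazy.regret T f (PartialLazy.ensemble R G T X g) u
            ≤ c * √((PartialLazy.pathLength T u + 1) * (T : ℝ)) := by
  obtain ⟨L, hL⟩ : ∃ L, L = 2 * R * (G + 1) := ⟨_, rfl⟩
  obtain ⟨b, hb⟩ : ∃ b, b = √((G ^ 2 + 2 * G) / R ^ 2) := ⟨_, rfl⟩
  obtain ⟨κ, hκ⟩ : ∃ κ, κ = 2 / ((2 * G + 1) * (2 * R)) * √(2 / 5) := ⟨_, rfl⟩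
  have hL0 : 0 < L := by rw [hL]; positivity
  have hb0 : 0 < b := by rw [hb]; positivity
  have hκ0 : 0 < κ := by rw [hκ]; positivity
  refine ⟨b * (R ^ 2 / 2 + 4 * R) * √(1 + R) + (G ^ 2 + G) * (2 * √(1 + 1 / R)) / b
    + 4 * √(1 + 1 / R) / κ + κ * L ^ 2 * Real.exp (κ * L)
    + R * (2 * (κ * L) * Real.exp (2 * (κ * L))), ?_⟩
  intro d T X hT hc hX h0 hXR f g _ hsub hg u hu
  have hXR' : ∀ x ∈ X, ‖x‖ ≤ R := fun x hx => mem_closedBall_zero_iff.1 (hXR hx)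
  have hT1 : (1 : ℝ) ≤ T := by exact_mod_cast hT
  have hP := PartialLazy.pathLength_le hT fun t ht => hXR' _ (hu t ht)
  have hP0 : 0 ≤ PartialLazy.pathLength T u := Finset.sum_nonneg fun _ _ => norm_nonneg _
  set P := PartialLazy.pathLength T u with hPdef
  -- the effective comparator variation `q`
  obtain ⟨q, hq⟩ : ∃ q, q = √(1 + P / R) := ⟨_, rfl⟩
  have hPR : 0 ≤ P / R := by positivity
  have hq1 : 1 ≤ q := by rw [hq]; exact Real.one_le_sqrt.2 (by linarith)
  have hq2 : q ^ 2 = 1 + P / R := by rw [hq]; exact Real.sq_sqrt (by linarith)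
  -- The path length is at most `2R(T - 1)`, so `q ^ 2 ≤ 2T - 1`, which is at most `8T - 7` for `T ≥
  -- 1`.
  have hqT : q ^ 2 ≤ 8 * (T : ℝ) - 7 := by
    have : P / R ≤ 2 * (T - 1) := by rw [div_le_iff₀ hR]; linarith
    rw [hq2]; linarith
  obtain ⟨i, hi, hqK, hKq⟩ := PartialLazy.exists_grid_index hT hq1 hqT
  obtain ⟨S, hS⟩ : ∃ S, S = √(T : ℝ) := ⟨_, rfl⟩
  have hS1 : 1 ≤ S := by rw [hS]; exact Real.one_le_sqrt.2 hT1
  have hS2 : (T : ℝ) = S ^ 2 := by rw [hS, Real.sq_sqrt (by linarith)]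
  obtain ⟨K, hK⟩ : ∃ K : ℝ, K = 2 ^ (i - 1) := ⟨_, rfl⟩
  have hK0 : 0 < K := by rw [hK]; positivity
  rw [← hK] at hqK hKq
  have hσ : b * S / K = PartialLazy.gridSigma R G T i := by
    rw [PartialLazy.gridSigma, hb, hS, hK, ← Real.sqrt_mul (by positivity)]
    congr 2
    ring
  have hα : κ / S = PartialLazy.metaStep R G T := by
    rw [PartialLazy.metaStep, hκ, hS, mul_div_assoc, ← Real.sqrt_div (by positivity), div_div]
  have hS0 : 0 < S := by linarith
  have main := PartialLazy.ensemble_regret_le hR hG hT hc hX h0 hXR' hsub hg hu hi hσ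
    (by positivity) hα (by positivity) hL
  rw [← hPdef, ← hK, hS2] at main
  obtain ⟨Q, hQ⟩ : ∃ Q, Q = √(P + 1) := ⟨_, rfl⟩
  have hQ1 : 1 ≤ Q := by rw [hQ]; exact Real.one_le_sqrt.2 (by linarith)
  have hQ2 : Q ^ 2 = P + 1 := by rw [hQ]; exact Real.sq_sqrt (by linarith)
  -- `Q = √(P + 1)` and `q = √(1 + P/R)` are comparable up to factors depending on `R` alone.
  have hr1 : Q ≤ √(1 + R) * K := by
    refine le_trans ?_ (mul_le_mul_of_nonneg_left hqK (Real.sqrt_nonneg _))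
    rw [hQ, hq, ← Real.sqrt_mul (by positivity)]
    refine Real.sqrt_le_sqrt ?_
    have : (1 + R) * (1 + P / R) = P + 1 + P / R + R := by field_simp; ring
    rw [this]; linarith
  have hr2 : K ≤ 2 * √(1 + 1 / R) * Q := by
    refine hKq.trans ?_
    rw [mul_assoc]
    refine mul_le_mul_of_nonneg_left ?_ zero_le_two
    rw [hQ, hq, ← Real.sqrt_mul (by positivity)]
    refine Real.sqrt_le_sqrt ?_
    have : (1 + 1 / R) * (P + 1) = 1 + P / R + P + 1 / R := by field_simp; ring
    have : 0 ≤ 1 / R := by positivity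
    linarith
  have hrhs : √((P + 1) * (S ^ 2)) = S * Q := by
    rw [Real.sqrt_mul (by linarith), Real.sqrt_sq hS0.le, ← hQ, mul_comm]
  rw [hS2, hrhs]
  exact main.trans (PartialLazy.tuned_bound_le hR hG hb0 hκ0 hL0 hS1 hK0 hQ1 hP0 hQ2 hr1 hr2)
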